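/- Let $\mathcal F$ be the class of distributions on $[0,\infty)$ with continuous cumulative distribution function $F$ and finite mean. For $F\in\mathcal F$ and integers $1\le k\le n$, let $\mathrm{OPT}_{n,k}(F)=\sum_{i=1}^k \mathbf E[X^{(i)}]$, where $X^{(1)}\ge\dots\ge X^{(n)}$ are the order statistics of $n$ independent samples from $F$. For $m\ge k$ and $q\in[0,1]$, let $\mathrm{ALG}_{m,k}(F,q)$ be the expected sum of the values accepted by the algorithm that observes $m$ independent samples $X_1,\dots,X_m$ from $F$ one by one and accepts the first (at most) $k$ of them that are at least $T=F^{-1}(1-q)=\inf\{t\ge 0: F(t)\ge 1-q\}$ (with $\inf\emptyset=\infty$). Define the single-threshold $(m,n,k)$-competitive ratio $$\gamma_{m,n,k}=\inf_{F\in\mathcal F}\ \sup_{q\in[0,1]}\frac{\mathrm{ALG}_{m,k}(F,q)}{\mathrm{OPT}_{n,k}(F)},$$ and, for $q\in[0,1]$, let $Q_{m,k}(q)=\mathbf E[\min\{k,Y\}]$ with $Y\sim\mathrm{Binomial}(m,q)$. **Theorem.** For all integers $k\ge 1$ and $n,m\ge k$, $$\gamma_{m,n,k}=\frac{Q_{m,k}(k/n)}{k}=\frac1k\left(k-\sum_{\ell=0}^{k-1}(k-\ell)\binom{m}{\ell}\left(\frac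 kn\right)^{\ell}\left(1-\frac kn\right)^{m-\ell}\right).$$ Moreover, the quantile $q=k/n$, which does not depend on $m$, is worst-case optimal: using it for every distribution already achieves the competitive ratio, $$\inf_{F\in\mathcal F}\frac{\mathrm{ALG}_{m,k}(F,k/n)}{\mathrm{OPT}_{n,k}(F)}=\gamma_{m,n,k},$$ and, for every $q\in[0,1]$, $$\inf_{F\in\mathcal F}\frac{\mathrm{ALG}_{m,k}(F,q)}{\mathrm{OPT}_{n,k}(F)}\le\inf_{F\in\mathcal F}\frac{\mathrm{ALG}_{m,k}(F,k/n)}{\mathrm{OPT}_{n,k}(F)}.$$ -/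

import Mathlib

open MeasureTheory ProbabilityTheory

namespace SingleThreshold

/-- The class of continuous distributions on `[0, ∞)` with finite mean, given by their laws. -/
structure IsContinuousDist (μ : Measure ℝ) : Prop where
  isProb : IsProbabilityMeasure μ
  nonneg : μ (Set.Iio 0) = 0
  continuous_cdf : Continuous (cdf μ)
  finite_mean : Integrable (fun x : ℝ => x) μ

/-- The law of `N` independent samples from `μ`. -/
noncomputable def iidLaw (μ : Measure ℝ) (N : ℕ) : Measure (Fin N → ℝ) :=
  Measure.pi fun _ => μ

/-- The order statistic of rank `i`, counted from the largest value (`i = 0`) downwards. -/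
noncomputable def orderStat {n : ℕ} (x : Fin n → ℝ) (i : Fin n) : ℝ :=
  x (Tuple.sort x i.rev)

/-- The prophet's value: the sum of the expectations of the `k` largest of `n` i.i.d. samples. -/
noncomputable def OPT (n k : ℕ) (μ : Measure ℝ) : ℝ :=
  ∑ i ∈ Finset.univ.filter (fun i : Fin n => (i : ℕ) < k), ∫ x, orderStat x i ∂(iidLaw μ n)

/-- The generalized inverse `F⁻¹(p)`, i.e. the least threshold `T ≥ 0` with `F(T) ≥ p`; it is `⊤`
(a threshold that accepts nothing) if there is no such real `T`, which for a distribution can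
happen only at `p = 1`. -/
noncomputable def quantileFn (μ : Measure ℝ) (p : ℝ) : EReal :=
  sInf ((fun T : ℝ => (T : EReal)) '' {T : ℝ | 0 ≤ T ∧ p ≤ cdf μ T})

open Classical in
/-- The positions accepted on the sequence `x` by the algorithm with threshold `T` and capacity `k`:
position `i` is accepted if its value is at least `T` and fewer than `k` earlier values were. -/
noncomputable def accepted {m : ℕ} (k : ℕ) (T : EReal) (x : Fin m → ℝ) : Finset (Fin m) :=
  {i : Fin m | T ≤ (x i : EReal) ∧
    (Finset.univ.filter fun j : Fin m => j < i ∧ T ≤ (x j : EReal)).card < k}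

/-- Expected total value accepted on `m` i.i.d. samples by the single-threshold algorithm with
capacity `k` and threshold `F⁻¹(1 - q)`. -/
noncomputable def ALG (m k : ℕ) (μ : Measure ℝ) (q : unitInterval) : ℝ :=
  ∫ x, (∑ i ∈ accepted k (quantileFn μ (1 - (q : ℝ))) x, x i) ∂(iidLaw μ m)

/-- The ratio between the algorithm with quantile `q` on `m` values and the prophet on `n` values. -/
noncomputable def ratio (m n k : ℕ) (μ : Measure ℝ) (q : unitInterval) : EReal :=
  ((ALG m k μ q / OPT n k μ : ℝ) : EReal)

/-- The single-threshold `(m, n, k)`-competitive ratio. -/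
noncomputable def competitiveRatio (m n k : ℕ) : EReal :=
  ⨅ (μ : Measure ℝ) (_ : IsContinuousDist μ), ⨆ q : unitInterval, ratio m n k μ q

/-- The worst-case ratio guaranteed by always using the quantile `q`. -/
noncomputable def guarantee (m n k : ℕ) (q : unitInterval) : EReal :=
  ⨅ (μ : Measure ℝ) (_ : IsContinuousDist μ), ratio m n k μ q

/-- `Q_{m,k}(q) = E[min {k, Y}]` for `Y` binomial with parameters `m` and `q`. -/
noncomputable def Q (m k : ℕ) (q : unitInterval) : ℝ :=
  ∫ y : ℕ, ((min k y : ℕ) : ℝ) ∂(binomial m q)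

/-- The quantile `k / n`. -/
noncomputable def quantileKN (k n : ℕ) (h : k ≤ n) : unitInterval :=
  ⟨(k : ℝ) / n, unitInterval.div_mem (Nat.cast_nonneg k) (Nat.cast_nonneg n) (Nat.cast_le.mpr h)⟩

end SingleThreshold

/-!
Let `Q(q) = E[min {k, Y}]` for `Y` binomial with parameters `m` and `q`.

*Lower bound.* Whether a position is still open is independent of the value found there, so the
algorithm with quantile `q` earns `Q(q)` times the conditional mean above the threshold
(`mul_integral_sum_accepted`): `q * ALG(q) = Q(q) * ∫_{x ≥ T} x`. The `k` largest of `n` samples add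
up to at most `k T + ∑ (X j - T)⁺`, whose mean is `n * ∫_{x ≥ T} x` when `T` has tail probability
`q = k / n` (`OPT_le`). So the quantile `k / n` always achieves the ratio `Q(k / n) / k`
(`le_guarantee`).

*Upper bound.* Take distributions that are nearly constant, of value `b`, except that with a small
probability `δ` the value is about `a / δ` (`worstCase`). As `δ → 0`, the prophet's value tends to
`k b + n a`, and the algorithm earns at most `Q(q) (a + b q) / q`, up to an error that is uniform
in `q`. The weights `a` and `b` have to be such that this expression is largest at `q = k / n`, that
is, such that `a + b q` touches `q / Q(q)` from below at `k / n`; then the ratio tends to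
`Q(k / n) / k` (`competitiveRatio_le`). They exist because `q / Q(q)` is convex on `(0, 1]`
(`exists_tangent`).

*Convexity.* With `G(q) = Q'(q) / m`, which is the probability that a binomial variable with
parameters `m - 1` and `q` is less than `k`, with `g = -G'`, a multiple of a beta density, and with
`W(q) = ∫_0^q u g(u) du`, one has `Q = m (W + q G)`, and convexity of `q / Q(q)` amounts to
`2 G W ≤ q g (W + q G)` (`two_mul_tail_mul_moment_le`). This follows from log-concavity of `g`.

Finally, no fixed quantile can guarantee more than the competitive ratio, since an infimum of values
at `q` is at most the infimum of the suprema over `q`.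
-/

namespace SingleThreshold

open Set Filter Topology

/-! ### An inequality for beta densities -/

/-- The derivative of `c x ^ K (1 - x) ^ j` on `(0, 1)`, in logarithmic form. -/
lemma hasDerivAt_pow_mul_one_sub_pow (c : ℝ) (K j : ℕ) {u : ℝ} (hu : u ∈ Ioo (0 : ℝ) 1) :
    HasDerivAt (fun u : ℝ => c * u ^ K * (1 - u) ^ j)
      (-(c * u ^ K * (1 - u) ^ j * (j / (1 - u) - K / u))) u := by
  have hu0 : u ≠ 0 := hu.1.ne'
  have hu1 : 1 - u ≠ 0 := by linarith [hu.2]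
  have h1 : HasDerivAt (fun u : ℝ => c * u ^ K) (c * (K * u ^ (K - 1))) u :=
    (hasDerivAt_pow K u).const_mul c
  have h2 : HasDerivAt (fun u : ℝ => (1 - u) ^ j) (j * (1 - u) ^ (j - 1) * (-1)) u :=
    ((hasDerivAt_id u).const_sub 1).pow j
  have e1 : (K : ℝ) * u ^ (K - 1) = K / u * u ^ K := by
    rcases K with _ | K
    · simp
    · rw [Nat.add_sub_cancel, pow_succ]; field_simp
  have e2 : (j : ℝ) * (1 - u) ^ (j - 1) = j / (1 - u) * (1 - u) ^ j := by
    rcases j with _ | j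
    · simp
    · rw [Nat.add_sub_cancel, pow_succ]; field_simp
  refine (h1.mul h2).congr_deriv ?_
  rw [e1, e2]
  ring

/-- Log-concavity of `g = c x ^ K (1 - x) ^ j` in the form of a bound on its tail integral
`G = ∫_x^1 g`: the reciprocal hazard rate `G / g` is at most `-g / g'`. -/
lemma tail_mul_neg_logDeriv_le {c : ℝ} (hc : 0 < c) (K j : ℕ) {G : ℝ → ℝ}
    (hG : ∀ x, HasDerivAt G (-(c * x ^ K * (1 - x) ^ j)) x) (hG1 : G 1 = 0)
    {x : ℝ} (hx : x ∈ Ioo (0 : ℝ) 1) :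
    G x * (j / (1 - x) - K / x) ≤ c * x ^ K * (1 - x) ^ j := by
  set κ : ℝ := j / (1 - x) - K / x with hκ
  have hd : ∀ u ∈ Ioo x 1, HasDerivAt (fun u : ℝ => c * u ^ K * (1 - u) ^ j - κ * G u)
      (-(c * u ^ K * (1 - u) ^ j * (j / (1 - u) - K / u)) - κ * (-(c * u ^ K * (1 - u) ^ j))) u :=
    fun u hu => (hasDerivAt_pow_mul_one_sub_pow c K j ⟨hx.1.trans hu.1, hu.2⟩).sub
      ((hG u).const_mul κ)
  have hGc : Continuous G := continuous_iff_continuousAt.2 fun u => (hG u).continuousAt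
  have hanti : AntitoneOn (fun u : ℝ => c * u ^ K * (1 - u) ^ j - κ * G u) (Icc x 1) := by
    refine antitoneOn_of_deriv_nonpos (convex_Icc x 1) (by fun_prop)
      (fun u hu => (hd u (by rwa [interior_Icc] at hu)).differentiableAt.differentiableWithinAt) ?_
    intro u hu
    rw [interior_Icc] at hu
    rw [(hd u hu).deriv]
    have hu0 : 0 < u := hx.1.trans hu.1
    have hu1 : 0 < 1 - u := by linarith [hu.2]
    have hx1 : 0 < 1 - x := by linarith [hx.2]
    have hκu : κ ≤ j / (1 - u) - K / u := by
      have h1 : (j : ℝ) / (1 - x) ≤ j / (1 - u) :=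
        div_le_div_of_nonneg_left (by positivity) hu1 (by linarith [hu.1])
      have h2 : (K : ℝ) / u ≤ K / x :=
        div_le_div_of_nonneg_left (by positivity) hx.1 hu.1.le
      linarith
    have hgpos : 0 ≤ c * u ^ K * (1 - u) ^ j := by positivity
    nlinarith [mul_nonneg hgpos (sub_nonneg.2 hκu)]
  have h := hanti (left_mem_Icc.2 hx.2.le) (right_mem_Icc.2 hx.2.le) hx.2.le
  have h0 : 0 ≤ c * (1 : ℝ) ^ K * (1 - 1) ^ j := by
    have : (0 : ℝ) ≤ (1 - 1) ^ j := pow_nonneg (by norm_num) j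
    positivity
  simp only [hG1] at h
  linarith

/-- The second-order condition for convexity of `x / (W x + x G x)`, where `G = ∫_x^1 g` and
`W = ∫_0^x u g` for the density `g = c x ^ K (1 - x) ^ j`. After division by `g` the difference of
the two sides vanishes at `0`, and its derivative `3 W + 2 G W g' / g ^ 2` is nonnegative by
log-concavity of `g`. -/
lemma two_mul_tail_mul_moment_le {c : ℝ} (hc : 0 < c) (K j : ℕ) {G W : ℝ → ℝ}
    (hG : ∀ x, HasDerivAt G (-(c * x ^ K * (1 - x) ^ j)) x) (hG1 : G 1 = 0)
    (hW : ∀ x, HasDerivAt W (x * (c * x ^ K * (1 - x) ^ j)) x) (hW0 : W 0 = 0)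
    {q : ℝ} (hq : q ∈ Ioo (0 : ℝ) 1) :
    2 * G q * W q ≤ q * (c * q ^ K * (1 - q) ^ j) * (W q + q * G q) := by
  have hGanti : AntitoneOn G (Icc 0 1) := by
    refine antitoneOn_of_deriv_nonpos (convex_Icc 0 1)
      (fun u _ => (hG u).continuousAt.continuousWithinAt)
      (fun u _ => (hG u).differentiableAt.differentiableWithinAt) ?_
    intro u hu
    rw [interior_Icc] at hu
    rw [(hG u).deriv]
    have := hu.1; have : 0 < 1 - u := by linarith [hu.2]
    have : 0 ≤ c * u ^ K * (1 - u) ^ j := by positivity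
    linarith
  have hGnn : ∀ x ∈ Ioo (0 : ℝ) 1, 0 ≤ G x := fun x hx => by
    have := hGanti (Ioo_subset_Icc_self hx) (right_mem_Icc.2 zero_le_one) hx.2.le
    rwa [hG1] at this
  have hWmono : MonotoneOn W (Icc 0 1) := by
    refine monotoneOn_of_deriv_nonneg (convex_Icc 0 1)
      (fun u _ => (hW u).continuousAt.continuousWithinAt)
      (fun u _ => (hW u).differentiableAt.differentiableWithinAt) ?_
    intro u hu
    rw [interior_Icc] at hu
    rw [(hW u).deriv]
    have := hu.1; have : 0 < 1 - u := by linarith [hu.2]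
    positivity
  have hWnn : ∀ x ∈ Ioo (0 : ℝ) 1, 0 ≤ W x := fun x hx => by
    have := hWmono (left_mem_Icc.2 zero_le_one) (Ioo_subset_Icc_self hx) hx.1.le
    rwa [hW0] at this
  have hWle : ∀ x ∈ Ioo (0 : ℝ) 1, W x ≤ c * x ^ (K + 2) := by
    have hd : ∀ u, HasDerivAt (fun u : ℝ => c * u ^ (K + 2) - W u)
        (c * ((K + 2 : ℕ) * u ^ (K + 1)) - u * (c * u ^ K * (1 - u) ^ j)) u :=
      fun u => ((hasDerivAt_pow (K + 2) u).const_mul c).sub (hW u)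
    have hm : MonotoneOn (fun u : ℝ => c * u ^ (K + 2) - W u) (Icc 0 1) := by
      refine monotoneOn_of_deriv_nonneg (convex_Icc 0 1)
        (fun u _ => (hd u).continuousAt.continuousWithinAt)
        (fun u _ => (hd u).differentiableAt.differentiableWithinAt) ?_
      intro u hu
      rw [interior_Icc] at hu
      rw [(hd u).deriv]
      have h0 := hu.1
      have h1 : (1 - u) ^ j ≤ 1 := pow_le_one₀ (by linarith [hu.2]) (by linarith)
      have h2 : 0 ≤ c * u ^ (K + 1) := by positivity
      have h3 : (0 : ℝ) ≤ K := by positivity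
      have e : u * (c * u ^ K * (1 - u) ^ j) = c * u ^ (K + 1) * (1 - u) ^ j := by ring
      rw [e]
      push_cast
      nlinarith [mul_nonneg h2 (sub_nonneg.2 h1), mul_nonneg h2 h3]
    intro x hx
    have := hm (left_mem_Icc.2 zero_le_one) (Ioo_subset_Icc_self hx) hx.1.le
    simp only [hW0, ne_eq, Nat.add_eq_zero_iff, OfNat.ofNat_ne_zero, and_false, not_false_eq_true,
      zero_pow, mul_zero, sub_zero] at this
    linarith
  set g : ℝ → ℝ := fun x => c * x ^ K * (1 - x) ^ j with hgdef
  have hgpos : ∀ x ∈ Ioo (0 : ℝ) 1, 0 < g x := fun x hx => by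
    have := hx.1; have : 0 < 1 - x := by linarith [hx.2]
    simp only [hgdef]; positivity
  have hgd : ∀ x ∈ Ioo (0 : ℝ) 1, HasDerivAt g (-(g x * (j / (1 - x) - K / x))) x :=
    fun u hu => hasDerivAt_pow_mul_one_sub_pow c K j hu
  -- the function here is the right side minus the left side, divided by `g`
  have hΦd : ∀ x ∈ Ioo (0 : ℝ) 1,
      HasDerivAt (fun x => x * W x + x ^ 2 * G x - 2 * (G x * W x / g x))
        (3 * W x - 2 * W x * (G x * (j / (1 - x) - K / x) / g x)) x := by
    intro x hx
    have hg0 := (hgpos x hx).ne'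
    have h1 := (hasDerivAt_id x).mul (hW x)
    have h2 := (hasDerivAt_pow 2 x).mul (hG x)
    have h3 := (((hG x).mul (hW x)).div (hgd x hx) hg0).const_mul 2
    refine ((h1.add h2).sub h3).congr_deriv ?_
    change 1 * W x + x * (x * g x) + (((2 : ℕ) : ℝ) * x ^ (2 - 1) * G x + x ^ 2 * -g x)
      - 2 * (((-g x * W x + G x * (x * g x)) * g x -
        G x * W x * -(g x * (j / (1 - x) - K / x))) / g x ^ 2) = _
    generalize (j / (1 - x) - K / x : ℝ) = κ
    field_simp
    push_cast
    ring
  have hΦmono : MonotoneOn (fun x => x * W x + x ^ 2 * G x - 2 * (G x * W x / g x))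
      (Ioo 0 1) := by
    refine monotoneOn_of_deriv_nonneg (convex_Ioo 0 1)
      (fun u hu => (hΦd u hu).continuousAt.continuousWithinAt)
      (fun u hu => (hΦd u (interior_subset hu)).differentiableAt.differentiableWithinAt) ?_
    intro u hu
    rw [interior_Ioo] at hu
    rw [(hΦd u hu).deriv]
    have h1 : G u * (j / (1 - u) - K / u) / g u ≤ 1 := by
      rw [div_le_one (hgpos u hu)]
      exact tail_mul_neg_logDeriv_le hc K j hG hG1 hu
    nlinarith [mul_nonneg (hWnn u hu) (sub_nonneg.2 h1), hWnn u hu]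
  have hΦnn : 0 ≤ q * W q + q ^ 2 * G q - 2 * (G q * W q / g q) := by
    -- near `0` the only negative term is small, since `W / g ≤ x ^ 2 / (1 - x) ^ j`
    have hlim : Tendsto (fun x : ℝ => -(2 * (G 0 * (x ^ 2 / (1 - x) ^ j)))) (𝓝[>] 0) (𝓝 0) := by
      have : ContinuousAt (fun x : ℝ => -(2 * (G 0 * (x ^ 2 / (1 - x) ^ j)))) 0 := by
        have : ((1 : ℝ) - 0) ^ j ≠ 0 := by simp
        fun_prop (disch := assumption)
      have h := this.tendsto
      simp only [ne_eq, OfNat.ofNat_ne_zero, not_false_eq_true, zero_pow, zero_div, mul_zero,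
        neg_zero] at h
      exact h.mono_left nhdsWithin_le_nhds
    refine le_of_tendsto hlim ?_
    filter_upwards [Ioo_mem_nhdsGT hq.1] with x hx
    have hx' : x ∈ Ioo (0 : ℝ) 1 := ⟨hx.1, hx.2.trans hq.2⟩
    refine le_trans ?_ (hΦmono hx' hq hx.2.le)
    have hx0 := hx'.1
    have hx1 : 0 < 1 - x := by linarith [hx'.2]
    have hW1 : W x / g x ≤ x ^ 2 / (1 - x) ^ j := by
      rw [div_le_div_iff₀ (hgpos x hx') (by positivity)]
      calc W x * (1 - x) ^ j ≤ c * x ^ (K + 2) * (1 - x) ^ j := by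
            gcongr; exact hWle x hx'
        _ = x ^ 2 * g x := by simp only [hgdef]; ring
    have hG0 : G x ≤ G 0 :=
      hGanti (left_mem_Icc.2 zero_le_one) (Ioo_subset_Icc_self hx') hx0.le
    have h1 : G x * W x / g x ≤ G 0 * (x ^ 2 / (1 - x) ^ j) := by
      rw [mul_div_assoc]
      exact mul_le_mul hG0 hW1 (div_nonneg (hWnn x hx') (hgpos x hx').le)
        ((hGnn x hx').trans hG0)
    have h2 : 0 ≤ x * W x := mul_nonneg hx0.le (hWnn x hx')
    have h3 : 0 ≤ x ^ 2 * G x := mul_nonneg (sq_nonneg x) (hGnn x hx')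
    linarith
  have hg0 := hgpos q hq
  have := mul_nonneg hΦnn hg0.le
  have e : (q * W q + q ^ 2 * G q - 2 * (G q * W q / g q)) * g q =
      q * g q * (W q + q * G q) - 2 * G q * W q := by
    field_simp
  rw [e] at this
  change _ ≤ q * g q * (W q + q * G q)
  linarith

/-! ### The capped binomial mean -/

section Polynomials

open Polynomial

/-- The probability `P(Y < k)` for `Y` binomial with parameters `m` and `q`, as a polynomial
in `q`. -/
noncomputable def lowerTail (m k : ℕ) : ℝ[X] :=
  ∑ l ∈ Finset.range k, bernsteinPolynomial ℝ m l

/-- The capped mean `E[min {k, Y}] = ∑_{i < k} P(Y > i)` for `Y` binomial with parameters `m` and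
`q`, as a polynomial in `q`. -/
noncomputable def cappedMean (m k : ℕ) : ℝ[X] :=
  ∑ i ∈ Finset.range k, (1 - lowerTail m (i + 1))

lemma derivative_lowerTail_succ (m k : ℕ) :
    derivative (lowerTail m (k + 1)) = -((m : ℝ[X]) * bernsteinPolynomial ℝ (m - 1) k) := by
  induction k with
  | zero => simp [lowerTail, bernsteinPolynomial.derivative_zero]
  | succ k ih =>
    rw [lowerTail, Finset.sum_range_succ, ← lowerTail, derivative_add, ih,
      bernsteinPolynomial.derivative_succ]
    ring

lemma derivative_cappedMean (m k : ℕ) :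
    derivative (cappedMean m k) = (m : ℝ[X]) * lowerTail (m - 1) k := by
  simp only [cappedMean, derivative_sum, derivative_sub, derivative_one,
    derivative_lowerTail_succ, zero_sub, neg_neg]
  rw [lowerTail, Finset.mul_sum]

lemma eval_lowerTail_zero (m k : ℕ) : (lowerTail m (k + 1)).eval 0 = 1 := by
  simp [lowerTail, eval_finsetSum, bernsteinPolynomial.eval_at_0]

lemma eval_lowerTail_one {m k : ℕ} (h : k ≤ m) : (lowerTail m k).eval 1 = 0 := by
  simp only [lowerTail, eval_finsetSum, bernsteinPolynomial.eval_at_1]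
  exact Finset.sum_eq_zero fun l hl => if_neg (by have := Finset.mem_range.1 hl; omega)

lemma eval_cappedMean_zero (m k : ℕ) : (cappedMean m k).eval 0 = 0 := by
  simp [cappedMean, eval_finsetSum, eval_lowerTail_zero]

lemma cappedMean_eq (m k : ℕ) :
    cappedMean m k =
      (k : ℝ[X]) - ∑ l ∈ Finset.range k, ((k : ℝ[X]) - l) * bernsteinPolynomial ℝ m l := by
  induction k with
  | zero => simp [cappedMean]
  | succ k ih =>
    rw [cappedMean, Finset.sum_range_succ, ← cappedMean, ih, Finset.sum_range_succ, lowerTail,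
      Finset.sum_range_succ]
    have : ∑ l ∈ Finset.range k, (((k + 1 : ℕ) : ℝ[X]) - l) * bernsteinPolynomial ℝ m l =
        ∑ l ∈ Finset.range k, ((k : ℝ[X]) - l) * bernsteinPolynomial ℝ m l +
          ∑ l ∈ Finset.range k, bernsteinPolynomial ℝ m l := by
      rw [← Finset.sum_add_distrib]
      refine Finset.sum_congr rfl fun l _ => ?_
      push_cast
      ring
    rw [this]
    push_cast
    ring

lemma eval_cappedMean_eq (m k : ℕ) (q : ℝ) :
    (cappedMean m k).eval q =
      k - ∑ l ∈ Finset.range k, ((k : ℝ) - l) * m.choose l * q ^ l * (1 - q) ^ (m - l) := by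
  simp [cappedMean_eq, eval_finsetSum, bernsteinPolynomial, mul_assoc]

/-- With `k = m` the cap is void, and the mean is that of the binomial distribution. -/
lemma eval_cappedMean_self {m : ℕ} (hm : 1 ≤ m) (q : ℝ) : (cappedMean m m).eval q = m * q := by
  have h1 : lowerTail (m - 1) m = 1 := by
    have := bernsteinPolynomial.sum ℝ (m - 1)
    rwa [Nat.sub_add_cancel hm] at this
  have h2 : derivative (cappedMean m m) = derivative ((m : ℝ[X]) * X) := by
    rw [derivative_cappedMean, h1]
    simp
  have h3 : derivative (cappedMean m m - (m : ℝ[X]) * X) = 0 := by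
    rw [derivative_sub, h2, sub_self]
  have hC := eq_C_of_natDegree_eq_zero (derivative_eq_zero.1 h3)
  have h4 := congrArg (eval q) hC
  have h5 := congrArg (eval 0) hC
  simp only [eval_sub, eval_mul, eval_natCast, eval_X, eval_C, eval_cappedMean_zero] at h4 h5
  linarith

lemma eval_lowerTail_le_one {m k : ℕ} (hk : k ≤ m + 1) {q : ℝ} (hq : q ∈ Icc (0 : ℝ) 1) :
    (lowerTail m k).eval q ≤ 1 := by
  have h1 := congrArg (eval q) (bernsteinPolynomial.sum ℝ m)
  rw [eval_finsetSum, eval_one] at h1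
  rw [lowerTail, eval_finsetSum, ← h1]
  refine Finset.sum_le_sum_of_subset_of_nonneg (Finset.range_mono hk) fun l _ _ => ?_
  have := hq.1
  have : 0 ≤ 1 - q := by linarith [hq.2]
  simp [bernsteinPolynomial]
  positivity

lemma eval_cappedMean_le {m k : ℕ} (hkm : k ≤ m) {q : ℝ} (hq : q ∈ Icc (0 : ℝ) 1) :
    (cappedMean m k).eval q ≤ m * q := by
  have hd : ∀ u : ℝ, HasDerivAt (fun u => m * u - (cappedMean m k).eval u)
      (m * 1 - m * (lowerTail (m - 1) k).eval u) u := fun u => by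
    refine ((hasDerivAt_id u).const_mul (m : ℝ)).sub ?_
    refine ((cappedMean m k).hasDerivAt u).congr_deriv ?_
    rw [derivative_cappedMean]
    simp
  have hm : MonotoneOn (fun u : ℝ => m * u - (cappedMean m k).eval u) (Icc 0 1) := by
    refine monotoneOn_of_deriv_nonneg (convex_Icc 0 1)
      (fun u _ => (hd u).continuousAt.continuousWithinAt)
      (fun u _ => (hd u).differentiableAt.differentiableWithinAt) ?_
    intro u hu
    rw [(hd u).deriv, ← mul_sub]
    exact mul_nonneg (Nat.cast_nonneg m)
      (sub_nonneg.2 (eval_lowerTail_le_one (by omega) (interior_subset hu)))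
  have h := hm (left_mem_Icc.2 zero_le_one) hq hq.1
  simp only [eval_cappedMean_zero, mul_zero, sub_zero] at h
  linarith

/-- A tangent line of the convex function `q / E[min {k, Y}]`, where `Y` is binomial with
parameters `m` and `q`. The numbers `a` and `b` are the weights of the rare huge values and of the
almost constant bulk in the worst-case distribution. -/
lemma exists_tangent {m k : ℕ} (hk : 1 ≤ k) (hkm : k ≤ m) {p : ℝ} (hp0 : 0 < p) (hp1 : p ≤ 1) :
    ∃ a b : ℝ, 0 ≤ a ∧ 0 ≤ b ∧
      (∀ q ∈ Icc (0 : ℝ) 1, (cappedMean m k).eval q * (a + b * q) ≤ q) ∧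
      0 < (cappedMean m k).eval p ∧ (cappedMean m k).eval p * (a + b * p) = p := by
  -- for `k = m` no position is ever closed, and `q / E[min {k, Y}]` is the constant `1 / m`
  rcases hkm.eq_or_lt with rfl | hlt
  · have hk0 : (0 : ℝ) < k := by exact_mod_cast hk
    refine ⟨1 / k, 0, by positivity, le_rfl, fun q _ => ?_, ?_, ?_⟩
    · rw [eval_cappedMean_self hk]; apply le_of_eq; field_simp; ring
    · rw [eval_cappedMean_self hk]; positivity
    · rw [eval_cappedMean_self hk]; field_simp; ring
  obtain ⟨K, rfl⟩ : ∃ K, k = K + 1 := ⟨k - 1, by omega⟩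
  obtain ⟨j, rfl⟩ : ∃ j, m = K + j + 2 := ⟨m - K - 2, by omega⟩
  set Q : ℝ → ℝ := fun q => (cappedMean (K + j + 2) (K + 1)).eval q with hQ
  set G : ℝ → ℝ := fun q => (lowerTail (K + j + 1) (K + 1)).eval q with hGdef
  set M : ℝ := ((K + j + 2 : ℕ) : ℝ) with hM
  have hM0 : 0 < M := by simp only [hM]; positivity
  set c : ℝ := ((K + j + 1 : ℕ) : ℝ) * ((K + j).choose K : ℝ) with hc
  have hc0 : 0 < c := by
    have : 0 < (K + j).choose K := Nat.choose_pos (by omega)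
    simp only [hc]; positivity
  have hQd : ∀ x, HasDerivAt Q (M * G x) x := fun x => by
    refine ((cappedMean (K + j + 2) (K + 1)).hasDerivAt x).congr_deriv ?_
    rw [derivative_cappedMean]
    simp [hM, hGdef]
  have hG : ∀ x, HasDerivAt G (-(c * x ^ K * (1 - x) ^ j)) x := fun x => by
    refine ((lowerTail (K + j + 1) (K + 1)).hasDerivAt x).congr_deriv ?_
    rw [derivative_lowerTail_succ]
    simp [hc, bernsteinPolynomial]
    ring
  have hG1 : G 1 = 0 := eval_lowerTail_one (by omega)
  have hQ0 : Q 0 = 0 := eval_cappedMean_zero _ _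
  -- `W x = ∫_0^x u g(u) du` for `g = -G'`, by integration by parts
  set W : ℝ → ℝ := fun x => Q x / M - x * G x with hWdef
  have hQW : ∀ x, Q x = M * (W x + x * G x) := fun x => by
    simp only [hWdef]; field_simp; ring
  have hW : ∀ x, HasDerivAt W (x * (c * x ^ K * (1 - x) ^ j)) x := fun x => by
    refine (((hQd x).div_const M).sub ((hasDerivAt_id x).mul (hG x))).congr_deriv ?_
    rw [mul_div_cancel_left₀ _ hM0.ne', id]
    ring
  have hW0 : W 0 = 0 := by simp [hWdef, hQ0]
  have hGnn : ∀ x ∈ Icc (0 : ℝ) 1, 0 ≤ G x := fun x hx => by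
    simp only [hGdef, lowerTail, eval_finsetSum]
    refine Finset.sum_nonneg fun l _ => ?_
    have := hx.1
    have : 0 ≤ 1 - x := by linarith [hx.2]
    simp [bernsteinPolynomial]
    positivity
  have hWpos : ∀ x ∈ Ioc (0 : ℝ) 1, 0 < W x := by
    have hm : StrictMonoOn W (Icc 0 1) := by
      refine strictMonoOn_of_deriv_pos (convex_Icc 0 1)
        (fun u _ => (hW u).continuousAt.continuousWithinAt) ?_
      intro u hu
      rw [interior_Icc] at hu
      rw [(hW u).deriv]
      have := hu.1; have : 0 < 1 - u := by linarith [hu.2]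
      positivity
    intro x hx
    have := hm (left_mem_Icc.2 zero_le_one) (Ioc_subset_Icc_self hx) hx.1
    rwa [hW0] at this
  have hQpos : ∀ x ∈ Ioc (0 : ℝ) 1, 0 < Q x := fun x hx => by
    rw [hQW]
    have := hWpos x hx
    have := mul_nonneg hx.1.le (hGnn x (Ioc_subset_Icc_self hx))
    positivity
  have hψd : ∀ x ∈ Ioc (0 : ℝ) 1, HasDerivAt (fun x => x / Q x) (M * W x / Q x ^ 2) x := by
    intro x hx
    refine ((hasDerivAt_id x).div (hQd x) (hQpos x hx).ne').congr_deriv ?_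
    congr 1
    simp only [id, one_mul]
    rw [hQW]
    ring
  -- by `hQW` the numerator below is `M ^ 2 * (x g (W + x G) - 2 G W)`
  have hψ'd : ∀ x ∈ Ioo (0 : ℝ) 1, HasDerivAt (fun x => M * W x / Q x ^ 2)
      (M * (x * (c * x ^ K * (1 - x) ^ j) * Q x - 2 * W x * (M * G x)) / Q x ^ 3) x := by
    intro x hx
    have h0 := (hQpos x (Ioo_subset_Ioc_self hx)).ne'
    refine (((hW x).const_mul M).div ((hQd x).pow 2) (pow_ne_zero 2 h0)).congr_deriv ?_
    simp only [Pi.pow_apply]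
    field_simp
    push_cast
    ring
  have hmono : MonotoneOn (fun x => M * W x / Q x ^ 2) (Ioc 0 1) := by
    refine monotoneOn_of_deriv_nonneg (convex_Ioc 0 1) ?_ ?_ ?_
    · intro x hx
      exact (((hW x).continuousAt.const_mul M).div ((hQd x).continuousAt.pow 2)
        (pow_ne_zero 2 (hQpos x hx).ne')).continuousWithinAt
    · intro x hx
      rw [interior_Ioc] at hx
      exact (hψ'd x hx).differentiableAt.differentiableWithinAt
    · intro x hx
      rw [interior_Ioc] at hx
      rw [(hψ'd x hx).deriv]
      have h1 := two_mul_tail_mul_moment_le hc0 K j hG hG1 hW hW0 hx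
      have h2 := hQpos x (Ioo_subset_Ioc_self hx)
      refine div_nonneg (mul_nonneg hM0.le ?_) (by positivity)
      rw [hQW]
      nlinarith [mul_le_mul_of_nonneg_left h1 hM0.le]
  have hconv : ConvexOn ℝ (Ioc 0 1) (fun x => x / Q x) := by
    refine MonotoneOn.convexOn_of_deriv (convex_Ioc 0 1)
      (fun x hx => (hψd x hx).continuousAt.continuousWithinAt)
      (fun x hx => (hψd x (interior_subset hx)).differentiableAt.differentiableWithinAt) ?_
    exact (hmono.mono interior_subset).congr fun x hx => ((hψd x (interior_subset hx)).deriv).symm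
  have hp : p ∈ Ioc (0 : ℝ) 1 := ⟨hp0, hp1⟩
  have hQp := hQpos p hp
  set b : ℝ := M * W p / Q p ^ 2 with hb
  refine ⟨p / Q p - b * p, b, ?_, ?_, ?_, hQp, ?_⟩
  · -- the intercept is `M p ^ 2 G(p) / Q(p) ^ 2`
    have : p / Q p - b * p = p * (M * (p * G p)) / Q p ^ 2 := by
      have e : M * (p * G p) = Q p - M * W p := by rw [hQW]; ring
      rw [hb, e]
      field_simp
    rw [this]
    have := hGnn p (Ioc_subset_Icc_self hp)
    positivity
  · have := hWpos p hp
    positivity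
  · intro q hq
    rcases hq.1.eq_or_lt with rfl | hq0
    · change Q 0 * _ ≤ _
      rw [hQ0]; simp
    have hq' : q ∈ Ioc (0 : ℝ) 1 := ⟨hq0, hq.2⟩
    have key : p / Q p + b * (q - p) ≤ q / Q q := by
      rcases lt_trichotomy q p with h | rfl | h
      · have := hconv.slope_le_of_hasDerivAt hq' hp h (hψd p hp)
        rw [slope_def_field, div_le_iff₀ (by linarith)] at this
        linarith
      · simp
      · have := hconv.le_slope_of_hasDerivAt hp hq' h (hψd p hp)
        rw [slope_def_field, le_div_iff₀ (by linarith)] at this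
        linarith
    rw [le_div_iff₀ (hQpos q hq')] at key
    calc Q q * (p / Q p - b * p + b * q) = (p / Q p + b * (q - p)) * Q q := by ring
      _ ≤ q := key
  · change Q p * _ = p
    field_simp
    ring

end Polynomials

/-! ### The expected reward of the algorithm -/

lemma Q_eq_eval_cappedMean {m k : ℕ} (hkm : k ≤ m) (q : unitInterval) :
    Q m k q = (cappedMean m k).eval (q : ℝ) := by
  rw [Q, integral_binomial, eval_cappedMean_eq]
  have h1 : ∑ l ∈ Finset.range (m + 1),
      ((m.choose l : ℝ) * (q : ℝ) ^ l * (1 - q) ^ (m - l)) = 1 := by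
    have := congrArg (Polynomial.eval (q : ℝ)) (bernsteinPolynomial.sum ℝ m)
    simpa [Polynomial.eval_finsetSum, bernsteinPolynomial] using this
  have h2 : Finset.Iic m = Finset.range (m + 1) := by ext; simp
  rw [h2]
  have h3 : ∑ l ∈ Finset.range k, ((k : ℝ) - l) * m.choose l * (q : ℝ) ^ l * (1 - q) ^ (m - l) =
      ∑ l ∈ Finset.range (m + 1), ((m.choose l : ℝ) * (q : ℝ) ^ l * (1 - q) ^ (m - l)) *
        (k - (min k l : ℕ)) := by
    rw [← Finset.sum_subset (Finset.range_mono (by omega : k ≤ m + 1))]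
    · refine Finset.sum_congr rfl fun l hl => ?_
      rw [min_eq_right (Finset.mem_range.1 hl).le]
      ring
    · intro l _ hl
      rw [Finset.mem_range, not_lt] at hl
      rw [min_eq_left hl]
      simp
  rw [h3]
  simp only [mul_sub, smul_eq_mul, Finset.sum_sub_distrib, ← Finset.sum_mul, h1, one_mul,
    sub_sub_cancel]

/-- Among the elements of `S`, those with fewer than `k` predecessors in `S` are the first
`min k #S`. -/
lemma card_filter_card_lt {α : Type*} [LinearOrder α] (k : ℕ) (S : Finset α) :
    (S.filter fun i => (S.filter fun j => j < i).card < k).card = min k S.card := by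
  induction S using Finset.induction_on_max with
  | empty => simp
  | insert a s ha ih =>
    have has : a ∉ s := fun h => lt_irrefl _ (ha a h)
    have e1 : (insert a s).filter (fun j => j < a) = s := by
      rw [Finset.filter_insert, if_neg (lt_irrefl a)]
      exact Finset.filter_true_of_mem ha
    have e2 : s.filter (fun i => ((insert a s).filter fun j => j < i).card < k) =
        s.filter (fun i => (s.filter fun j => j < i).card < k) := by
      refine Finset.filter_congr fun i hi => ?_
      rw [Finset.filter_insert, if_neg (ha i hi).not_gt]
    rw [Finset.filter_insert, e1, e2, Finset.card_insert_of_notMem has]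
    split_ifs with h
    · rw [Finset.card_insert_of_notMem (by simp [has]), ih]
      omega
    · rw [ih]
      omega

open Classical in
lemma card_accepted {m : ℕ} (k : ℕ) (T : EReal) (x : Fin m → ℝ) :
    (accepted k T x).card = min k (Finset.univ.filter fun i => T ≤ (x i : EReal)).card := by
  rw [← card_filter_card_lt, accepted, Finset.filter_filter]
  congr 1
  refine Finset.filter_congr fun i _ => ?_
  rw [Finset.filter_filter]
  simp only [and_comm]

variable {μ : Measure ℝ}

lemma measurableSet_threshold (T : EReal) : MeasurableSet {y : ℝ | T ≤ (y : EReal)} :=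
  measurableSet_le measurable_const measurable_coe_real_ereal

instance [IsProbabilityMeasure μ] (N : ℕ) : IsProbabilityMeasure (iidLaw μ N) := by
  unfold iidLaw; infer_instance

lemma measurePreserving_eval_iidLaw [IsProbabilityMeasure μ] {N : ℕ} (i : Fin N) :
    MeasurePreserving (fun x : Fin N → ℝ => x i) (iidLaw μ N) μ :=
  measurePreserving_eval (fun _ => μ) i

open Classical in
/-- The number of samples in a set of mass `p` is binomial with parameter `p`. -/
lemma integral_card_filter_mem [IsProbabilityMeasure μ] {A : Set ℝ} (hA : MeasurableSet A) (m : ℕ)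
    (p : unitInterval) (hp : μ.real A = p) (h : ℕ → ℝ) :
    ∫ x, h (Finset.univ.filter fun i => x i ∈ A).card ∂(iidLaw μ m) =
      ∫ y, h y ∂(binomial m p) := by
  have hset : ∀ S : Finset (Fin m), {x : Fin m → ℝ | (Finset.univ.filter fun i => x i ∈ A) = S} =
      Set.pi univ fun i => if i ∈ S then A else Aᶜ := by
    intro S
    ext x
    simp only [Set.mem_ofPred_eq, Set.mem_pi, mem_univ, true_imp_iff, Finset.ext_iff,
      Finset.mem_filter, Finset.mem_univ, true_and]
    refine forall_congr' fun i => ?_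
    by_cases hi : i ∈ S <;> simp [hi]
  have hmeas : ∀ S : Finset (Fin m),
      MeasurableSet {x : Fin m → ℝ | (Finset.univ.filter fun i => x i ∈ A) = S} := by
    intro S
    rw [hset]
    refine MeasurableSet.univ_pi fun i => ?_
    split_ifs
    exacts [hA, hA.compl]
  have hmass : ∀ S : Finset (Fin m),
      (iidLaw μ m).real {x : Fin m → ℝ | (Finset.univ.filter fun i => x i ∈ A) = S} =
        (p : ℝ) ^ S.card * (1 - p) ^ (m - S.card) := by
    intro S
    rw [hset, Measure.real, iidLaw, Measure.pi_pi, ENNReal.toReal_prod]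
    have : ∀ i, (μ (if i ∈ S then A else Aᶜ)).toReal = if i ∈ S then (p : ℝ) else 1 - p := by
      intro i
      split_ifs
      · exact hp
      · rw [← hp]
        exact probReal_compl_eq_one_sub hA
    simp only [this]
    rw [Finset.prod_ite, Finset.prod_const, Finset.prod_const]
    congr 2
    · congr 1
      ext; simp
    · rw [Finset.filter_not, Finset.card_sdiff]
      simp
  have hdecomp : ∀ x : Fin m → ℝ, h (Finset.univ.filter fun i => x i ∈ A).card =
      ∑ S : Finset (Fin m), {x : Fin m → ℝ | (Finset.univ.filter fun i => x i ∈ A) = S}.indicator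
        (fun _ => h S.card) x := by
    intro x
    rw [Finset.sum_eq_single (Finset.univ.filter fun i => x i ∈ A)]
    · simp
    · intro S _ hS
      exact indicator_of_notMem (fun h => hS h.symm) _
    · simp
  simp only [hdecomp]
  rw [integral_finsetSum _ fun S _ => (integrable_const _).indicator (hmeas S)]
  simp only [integral_indicator_const _ (hmeas _), hmass, smul_eq_mul]
  rw [integral_binomial, ← Finset.powerset_univ, Finset.sum_powerset_apply_card
    (fun l => (p : ℝ) ^ l * (1 - p) ^ (m - l) * h l)]
  have h2 : Finset.Iic m = Finset.range (m + 1) := by ext; simp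
  rw [h2, Finset.card_univ, Fintype.card_fin]
  refine Finset.sum_congr rfl fun l _ => ?_
  simp only [nsmul_eq_mul, smul_eq_mul]
  ring

open Classical in
/-- Whether position `i` is still open when it is reached is independent of the value there, so the
expected total of `f` over the accepted positions is a constant, independent of `f`, times the
integral of `f` over the values above the threshold. -/
lemma exists_integral_sum_accepted [IsProbabilityMeasure μ] (m k : ℕ) (T : EReal) :
    ∃ C : ℝ, ∀ f : ℝ → ℝ, Measurable f → Integrable f μ →
      ∫ x, (∑ i ∈ accepted k T x, f (x i)) ∂(iidLaw μ m) =
        C * ∫ y in {y : ℝ | T ≤ (y : EReal)}, f y ∂μ := by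
  set A : Set ℝ := {y : ℝ | T ≤ (y : EReal)} with hAdef
  have hA : MeasurableSet A := measurableSet_threshold T
  -- `ψ i` is the event that position `i` is open, as a function of the earlier values `r i x`
  let ψ : ∀ i : Fin m, (↥(Finset.Iio i) → ℝ) → ℝ := fun i y =>
    {y : ↥(Finset.Iio i) → ℝ | ∑ j, A.indicator (fun _ => (1 : ℝ)) (y j) < k}.indicator
      (fun _ => 1) y
  have hψm : ∀ i, Measurable (ψ i) := by
    intro i
    refine measurable_const.indicator (measurableSet_lt ?_ measurable_const)
    exact Finset.measurable_sum _ fun j _ =>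
      (measurable_const.indicator hA).comp (measurable_pi_apply j)
  let r : ∀ i : Fin m, (Fin m → ℝ) → (↥(Finset.Iio i) → ℝ) := fun i x j => x j
  have hr : ∀ i, Measurable (r i) := fun i => measurable_pi_lambda _ fun j => measurable_pi_apply _
  have hψ : ∀ i x, ψ i (r i x) =
      if (Finset.univ.filter fun j : Fin m => j < i ∧ T ≤ (x j : EReal)).card < k
        then 1 else 0 := by
    intro i x
    have : ∑ j : ↥(Finset.Iio i), A.indicator (fun _ => (1 : ℝ)) (r i x j) =
        ((Finset.univ.filter fun j : Fin m => j < i ∧ T ≤ (x j : EReal)).card : ℝ) := by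
      rw [Finset.sum_coe_sort (Finset.Iio i) (fun j => A.indicator (fun _ => (1 : ℝ)) (x j)),
        Finset.card_eq_sum_ones, ← Finset.filter_filter, Finset.sum_filter]
      have e : Finset.univ.filter (fun j => j < i) = Finset.Iio i := by ext; simp
      rw [e]
      push_cast
      refine Finset.sum_congr rfl fun j _ => ?_
      simp [indicator_apply, hAdef]
    change (if ∑ j, A.indicator (fun _ => (1 : ℝ)) (r i x j) < k then (1 : ℝ) else 0) = _
    simp only [this, Nat.cast_lt]
  have hψint : ∀ i, Integrable (fun x => ψ i (r i x)) (iidLaw μ m) := by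
    intro i
    refine Integrable.of_bound ((hψm i).comp (hr i)).aestronglyMeasurable 1
      (ae_of_all _ fun x => ?_)
    simp only [hψ]
    split_ifs <;> simp
  refine ⟨∑ i, ∫ x, ψ i (r i x) ∂(iidLaw μ m), fun f hf hfi => ?_⟩
  have hfA : Measurable (A.indicator f) := hf.indicator hA
  have hfAi : Integrable (A.indicator f) μ := hfi.indicator hA
  have hind : ∀ i : Fin m, IndepFun (fun x : Fin m → ℝ => A.indicator f (x i))
      (fun x => ψ i (r i x)) (iidLaw μ m) := by
    intro i
    have h0 : iIndepFun (fun (i : Fin m) (x : Fin m → ℝ) => x i) (iidLaw μ m) :=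
      iIndepFun_pi (X := fun _ => id) fun _ => aemeasurable_id
    have h1 := h0.indepFun_finset {i} (Finset.Iio i) (by simp) fun j => measurable_pi_apply j
    let φ : (↥({i} : Finset (Fin m)) → ℝ) → ℝ := fun y => A.indicator f (y ⟨i, by simp⟩)
    have hφ : Measurable φ := hfA.comp (measurable_pi_apply _)
    exact h1.comp hφ (hψm i)
  have hsum : ∀ x : Fin m → ℝ, ∑ i ∈ accepted k T x, f (x i) =
      ∑ i, A.indicator f (x i) * ψ i (r i x) := by
    intro x
    rw [accepted, Finset.sum_filter]
    refine Finset.sum_congr rfl fun i _ => ?_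
    rw [hψ, indicator_apply]
    by_cases h1 : T ≤ (x i : EReal) <;>
    by_cases h2 : (Finset.univ.filter fun j : Fin m => j < i ∧ T ≤ (x j : EReal)).card < k <;>
    simp [hAdef, h1, h2]
  have hev : ∀ i : Fin m, ∫ x, A.indicator f (x i) ∂(iidLaw μ m) = ∫ y in A, f y ∂μ := by
    intro i
    rw [← integral_indicator hA]
    have := (measurePreserving_eval_iidLaw (μ := μ) i).map_eq
    conv_rhs => rw [← this]
    exact (integral_map (measurable_pi_apply i).aemeasurable hfA.aestronglyMeasurable).symm
  have hevi : ∀ i : Fin m, Integrable (fun x => A.indicator f (x i)) (iidLaw μ m) := fun i =>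
    (measurePreserving_eval_iidLaw (μ := μ) i).integrable_comp_of_integrable hfAi
  have hint : ∀ i : Fin m, Integrable (fun x => A.indicator f (x i) * ψ i (r i x)) (iidLaw μ m) :=
    fun i => (hind i).integrable_mul (hevi i) (hψint i)
  simp only [hsum]
  rw [integral_finsetSum _ fun i _ => hint i, Finset.sum_mul]
  refine Finset.sum_congr rfl fun i _ => ?_
  rw [(hind i).integral_fun_mul_eq_mul_integral (hevi i).aestronglyMeasurable
    (hψint i).aestronglyMeasurable, hev, mul_comm]

/-- If values above the threshold have probability `q > 0`, the expected accepted total is the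
expected number of accepted values times the conditional mean above the threshold. -/
lemma mul_integral_sum_accepted [IsProbabilityMeasure μ] (m k : ℕ) (T : EReal)
    (q : unitInterval) (hq : μ.real {y : ℝ | T ≤ (y : EReal)} = q)
    (hμ : Integrable (fun x : ℝ => x) μ) :
    (q : ℝ) * ∫ x, (∑ i ∈ accepted k T x, x i) ∂(iidLaw μ m) =
      Q m k q * ∫ y in {y : ℝ | T ≤ (y : EReal)}, y ∂μ := by
  classical
  obtain ⟨C, hC⟩ := exists_integral_sum_accepted (μ := μ) m k T
  have h1 := hC (fun _ => 1) measurable_const (integrable_const 1)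
  have h2 := hC (fun y => y) measurable_id hμ
  obtain ⟨A, hA⟩ : ∃ A : Set ℝ, A = {y : ℝ | T ≤ (y : EReal)} := ⟨_, rfl⟩
  rw [← hA] at h1 h2 hq ⊢
  have h3 : ∀ x : Fin m → ℝ, ∑ i ∈ accepted k T x, (1 : ℝ) =
      ((min k (Finset.univ.filter fun i => x i ∈ A).card : ℕ) : ℝ) := by
    intro x
    subst hA
    rw [Finset.sum_const, nsmul_one, card_accepted]
    simp only [Set.mem_ofPred_eq]
  simp only [h3] at h1
  rw [integral_card_filter_mem (hA ▸ measurableSet_threshold T) m q hq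
    (fun y => ((min k y : ℕ) : ℝ)), setIntegral_const, hq] at h1
  rw [h2, Q, h1]
  simp only [smul_eq_mul, mul_one]
  ring

/-! ### Quantiles of continuous distributions -/

lemma continuous_cdf [IsProbabilityMeasure μ] [NullSingletonClass μ] : Continuous (cdf μ) := by
  refine continuous_iff_continuousAt.2 fun a => ?_
  rw [(cdf μ).mono.continuousAt_iff_leftLim_eq_rightLim, StieltjesFunction.rightLim_eq]
  refine le_antisymm ((cdf μ).mono.leftLim_le le_rfl) ?_
  have h : (cdf μ).measure {a} = 0 := by rw [measure_cdf]; exact measure_singleton a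
  rw [StieltjesFunction.measure_singleton, ENNReal.ofReal_eq_zero] at h
  linarith

lemma IsContinuousDist.nullSingletonClass (hμ : IsContinuousDist μ) : NullSingletonClass μ := by
  have := hμ.isProb
  refine ⟨fun a => ?_⟩
  rw [← measure_cdf μ, StieltjesFunction.measure_singleton,
    (cdf μ).mono.continuousWithinAt_Iio_iff_leftLim_eq.1
      hμ.continuous_cdf.continuousAt.continuousWithinAt, sub_self, ENNReal.ofReal_zero]

lemma IsContinuousDist.measure_Iic_zero (hμ : IsContinuousDist μ) : μ (Iic 0) = 0 := by
  have := hμ.nullSingletonClass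
  rw [← Iio_union_right, measure_union_null hμ.nonneg (measure_singleton 0)]

lemma IsContinuousDist.ae_pos (hμ : IsContinuousDist μ) : ∀ᵐ x ∂μ, 0 < x := by
  filter_upwards [measure_eq_zero_iff_ae_notMem.1 hμ.measure_Iic_zero] with x hx using not_le.1 hx

/-- The generalized inverse at a level `p` that `F` reaches is a finite threshold, and continuity
makes it a genuine preimage of `p`. -/
lemma exists_quantileFn_eq (hμ : IsContinuousDist μ) {p : ℝ} (hp : 0 ≤ p) {s : ℝ} (hs : 0 ≤ s)
    (hps : p ≤ cdf μ s) : ∃ t : ℝ, quantileFn μ p = t ∧ cdf μ t = p := by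
  have := hμ.isProb
  set S : Set ℝ := {T : ℝ | 0 ≤ T ∧ p ≤ cdf μ T} with hS
  have hcl : IsClosed S :=
    (isClosed_le continuous_const continuous_id).inter
      (isClosed_le continuous_const hμ.continuous_cdf)
  have hbdd : BddBelow S := ⟨0, fun x hx => hx.1⟩
  have hmem : sInf S ∈ S := hcl.csInf_mem ⟨s, hs, hps⟩ hbdd
  have hleast : IsLeast S (sInf S) := ⟨hmem, fun x hx => csInf_le hbdd hx⟩
  refine ⟨sInf S, ?_, ?_⟩
  · have : Monotone (fun T : ℝ => (T : EReal)) := fun _ _ h => EReal.coe_le_coe_iff.2 h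
    exact (this.map_isLeast hleast).isGLB.sInf_eq
  · have h0 : cdf μ 0 = 0 := by
      rw [cdf_eq_real, Measure.real, hμ.measure_Iic_zero, ENNReal.toReal_zero]
    obtain ⟨u, hu, hup⟩ := intermediate_value_Icc hmem.1 hμ.continuous_cdf.continuousOn
      (show p ∈ Icc (cdf μ 0) (cdf μ (sInf S)) from ⟨h0.symm ▸ hp, hmem.2⟩)
    have : sInf S ≤ u := hleast.2 ⟨hu.1, hup.ge⟩
    rwa [← le_antisymm hu.2 this]

lemma exists_le_cdf (μ : Measure ℝ) {p : ℝ} (hp : p < 1) : ∃ s : ℝ, 0 ≤ s ∧ p ≤ cdf μ s := by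
  obtain ⟨s, hs, h0⟩ := (((tendsto_cdf_atTop μ).eventually_const_lt hp).and
    (eventually_ge_atTop 0)).exists
  exact ⟨s, h0, hs.le⟩

lemma measureReal_Ici_of_cdf (hμ : IsContinuousDist μ) {t p : ℝ} (ht : cdf μ t = 1 - p) :
    μ.real (Ici t) = p := by
  have := hμ.isProb
  have := hμ.nullSingletonClass
  rw [← compl_Iio, probReal_compl_eq_one_sub measurableSet_Iio,
    measureReal_congr (Iio_ae_eq_Iic (μ := μ) (a := t)), ← cdf_eq_real, ht]
  ring

/-- The threshold `F⁻¹(1 - q)` is exceeded with probability exactly `q`, also at `q = 0`, where it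
may be infinite. -/
lemma measureReal_quantileFn_le (hμ : IsContinuousDist μ) (q : unitInterval) :
    μ.real {y : ℝ | quantileFn μ (1 - (q : ℝ)) ≤ (y : EReal)} = q := by
  by_cases h : ∃ s : ℝ, 0 ≤ s ∧ 1 - (q : ℝ) ≤ cdf μ s
  · obtain ⟨s, hs, hps⟩ := h
    obtain ⟨t, ht, hct⟩ := exists_quantileFn_eq hμ (by linarith [q.2.2]) hs hps
    rw [ht]
    simp only [EReal.coe_le_coe_iff]
    exact measureReal_Ici_of_cdf hμ hct
  · have hq : (q : ℝ) = 0 := by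
      by_contra hne
      have : 0 < (q : ℝ) := lt_of_le_of_ne q.2.1 (Ne.symm hne)
      exact h (exists_le_cdf μ (by linarith))
    have hS : {T : ℝ | 0 ≤ T ∧ 1 - (q : ℝ) ≤ cdf μ T} = ∅ :=
      eq_empty_iff_forall_notMem.2 fun T hT => h ⟨T, hT⟩
    rw [quantileFn, hS, image_empty, sInf_empty, hq]
    simp

/-- The expected reward of the algorithm, multiplied by `q`; at `q = 0`, where this says nothing,
there is `ALG_zero`. -/
lemma mul_ALG (hμ : IsContinuousDist μ) (m k : ℕ) (q : unitInterval) :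
    (q : ℝ) * ALG m k μ q =
      Q m k q * ∫ y in {y : ℝ | quantileFn μ (1 - (q : ℝ)) ≤ (y : EReal)}, y ∂μ :=
  have := hμ.isProb
  mul_integral_sum_accepted m k _ q (measureReal_quantileFn_le hμ q) hμ.finite_mean

lemma ALG_zero (hμ : IsContinuousDist μ) (m k : ℕ) : ALG m k μ 0 = 0 := by
  have := hμ.isProb
  obtain ⟨C, hC⟩ := exists_integral_sum_accepted (μ := μ) m k (quantileFn μ (1 - (0 : ℝ)))
  have h : μ.real {y : ℝ | quantileFn μ (1 - (0 : ℝ)) ≤ (y : EReal)} = 0 :=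
    measureReal_quantileFn_le hμ 0
  rw [measureReal_eq_zero_iff] at h
  have := hC (fun y => y) measurable_id hμ.finite_mean
  rw [setIntegral_measure_zero _ h, mul_zero] at this
  exact this

/-! ### Order statistics and the prophet -/

lemma orderStat_antitone {n : ℕ} (x : Fin n → ℝ) : Antitone (orderStat x) := fun _ _ hij =>
  Tuple.monotone_sort x (Fin.rev_le_rev.2 hij)

lemma le_orderStat_zero {n : ℕ} (x : Fin n → ℝ) (hn : 0 < n) (j : Fin n) :
    x j ≤ orderStat x ⟨0, hn⟩ := by
  have h := orderStat_antitone x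
    (show (⟨0, hn⟩ : Fin n) ≤ ((Tuple.sort x).symm j).rev from Nat.zero_le _)
  simpa [orderStat] using h

/-- The sorting permutation takes finitely many values, each on a set cut out by comparisons of
coordinates. -/
lemma measurable_orderStat {n : ℕ} (i : Fin n) : Measurable fun x : Fin n → ℝ => orderStat x i := by
  classical
  have hm : ∀ σ : Equiv.Perm (Fin n), MeasurableSet {x : Fin n → ℝ | Tuple.sort x = σ} := by
    intro σ
    have : {x : Fin n → ℝ | Tuple.sort x = σ} =
        (⋂ a, ⋂ b, ⋂ (_ : a ≤ b), {x : Fin n → ℝ | x (σ a) ≤ x (σ b)}) ∩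
        ⋂ a, ⋂ b, ⋂ (_ : a < b), ⋂ (_ : ¬ σ a < σ b), {x : Fin n → ℝ | x (σ a) = x (σ b)}ᶜ := by
      ext x
      simp only [Set.mem_ofPred_eq, mem_inter_iff, mem_iInter, mem_compl_iff]
      rw [eq_comm, Tuple.eq_sort_iff]
      refine and_congr Iff.rfl ?_
      refine forall_congr' fun a => forall_congr' fun b => forall_congr' fun _ => ?_
      tauto
    rw [this]
    refine MeasurableSet.inter ?_ ?_
    · refine MeasurableSet.iInter fun a => MeasurableSet.iInter fun b => ?_
      exact MeasurableSet.iInter fun _ =>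
        measurableSet_le (measurable_pi_apply _) (measurable_pi_apply _)
    · refine MeasurableSet.iInter fun a => MeasurableSet.iInter fun b => ?_
      exact MeasurableSet.iInter fun _ =>
        MeasurableSet.iInter fun _ =>
          (measurableSet_eq_fun (measurable_pi_apply (σ a)) (measurable_pi_apply (σ b))).compl
  have hsum : (fun x : Fin n → ℝ => orderStat x i) = fun x => ∑ σ : Equiv.Perm (Fin n),
      {x : Fin n → ℝ | Tuple.sort x = σ}.indicator (fun x => x (σ i.rev)) x := by
    funext x
    rw [Finset.sum_eq_single (Tuple.sort x)]
    · simp [orderStat]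
    · intro σ _ hσ
      exact indicator_of_notMem (fun h => hσ h.symm) _
    · simp
  rw [hsum]
  exact Finset.measurable_sum _ fun σ _ => (measurable_pi_apply _).indicator (hm σ)

lemma integrable_eval_iidLaw [IsProbabilityMeasure μ] {n : ℕ} {f : ℝ → ℝ} (hf : Integrable f μ)
    (j : Fin n) : Integrable (fun x : Fin n → ℝ => f (x j)) (iidLaw μ n) :=
  (measurePreserving_eval_iidLaw j).integrable_comp_of_integrable hf

lemma integral_eval_iidLaw [IsProbabilityMeasure μ] {n : ℕ} {f : ℝ → ℝ} (hf : Integrable f μ)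
    (j : Fin n) : ∫ x, f (x j) ∂(iidLaw μ n) = ∫ y, f y ∂μ := by
  have h := (measurePreserving_eval_iidLaw (μ := μ) j).map_eq
  have hf' : AEStronglyMeasurable f (Measure.map (fun x : Fin n → ℝ => x j) (iidLaw μ n)) := by
    rw [h]; exact hf.aestronglyMeasurable
  rw [← integral_map (measurable_pi_apply j).aemeasurable hf', h]

lemma ae_forall_eval_iidLaw [IsProbabilityMeasure μ] {n : ℕ} {P : ℝ → Prop} (h : ∀ᵐ y ∂μ, P y) :
    ∀ᵐ x ∂(iidLaw μ n), ∀ j, P (x j) :=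
  ae_all_iff.2 fun j => (measurePreserving_eval_iidLaw (μ := μ) j).quasiMeasurePreserving.ae h

lemma integrable_orderStat [IsProbabilityMeasure μ] (hμ : Integrable (fun x : ℝ => x) μ) {n : ℕ}
    (i : Fin n) : Integrable (fun x : Fin n → ℝ => orderStat x i) (iidLaw μ n) := by
  refine (integrable_finsetSum Finset.univ fun j _ => (integrable_eval_iidLaw hμ j).norm).mono'
    (measurable_orderStat i).aestronglyMeasurable (ae_of_all _ fun x => ?_)
  exact Finset.single_le_sum (f := fun j => ‖x j‖) (fun j _ => norm_nonneg _) (Finset.mem_univ _)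

/-- The sum of the `k` largest entries of `x`. -/
noncomputable def topSum {n : ℕ} (k : ℕ) (x : Fin n → ℝ) : ℝ :=
  ∑ i ∈ Finset.univ.filter (fun i : Fin n => (i : ℕ) < k), orderStat x i

lemma integrable_topSum [IsProbabilityMeasure μ] (hμ : Integrable (fun x : ℝ => x) μ) (n k : ℕ) :
    Integrable (fun x : Fin n → ℝ => topSum k x) (iidLaw μ n) :=
  integrable_finsetSum _ fun i _ => integrable_orderStat hμ i

lemma OPT_eq_integral_topSum [IsProbabilityMeasure μ] (hμ : Integrable (fun x : ℝ => x) μ)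
    (n k : ℕ) : OPT n k μ = ∫ x, topSum k x ∂(iidLaw μ n) :=
  (integral_finsetSum _ fun i _ => integrable_orderStat hμ i).symm

lemma card_filter_val_lt {n k : ℕ} (hkn : k ≤ n) :
    (Finset.univ.filter fun i : Fin n => (i : ℕ) < k).card = k := by
  rw [Fin.card_filter_val_lt, min_eq_right hkn]

lemma topSum_le {n k : ℕ} (hkn : k ≤ n) (x : Fin n → ℝ) (t : ℝ) :
    topSum k x ≤ k * t + ∑ j, max (x j - t) 0 := by
  have h1 : topSum k x ≤ ∑ i ∈ Finset.univ.filter (fun i : Fin n => (i : ℕ) < k),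
      (t + max (orderStat x i - t) 0) :=
    Finset.sum_le_sum fun i _ => by linarith [le_max_left (orderStat x i - t) 0]
  have h2 : ∑ i ∈ Finset.univ.filter (fun i : Fin n => (i : ℕ) < k), max (orderStat x i - t) 0 ≤
      ∑ i, max (orderStat x i - t) 0 :=
    Finset.sum_le_sum_of_subset_of_nonneg (Finset.filter_subset _ _) fun _ _ _ => le_max_right _ _
  have h3 : ∑ i, max (orderStat x i - t) 0 = ∑ j, max (x j - t) 0 :=
    Equiv.sum_comp (Fin.revPerm.trans (Tuple.sort x)) fun j => max (x j - t) 0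
  rw [Finset.sum_add_distrib, Finset.sum_const, card_filter_val_lt hkn, nsmul_eq_mul] at h1
  linarith

/-- The `k` largest entries include a largest one, and the others are at least `b`. -/
lemma mul_le_topSum {n k : ℕ} (hk : 1 ≤ k) (hkn : k ≤ n) (x : Fin n → ℝ) {b : ℝ}
    (hb : ∀ j, b ≤ x j) (j : Fin n) : k * b + (x j - b) ≤ topSum k x := by
  have hn : 0 < n := by omega
  have h1 : ∑ i ∈ Finset.univ.filter (fun i : Fin n => (i : ℕ) < k), (orderStat x i - b) =
      topSum k x - k * b := by
    rw [Finset.sum_sub_distrib, Finset.sum_const, card_filter_val_lt hkn, nsmul_eq_mul, topSum]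
  have h2 := Finset.single_le_sum (f := fun i => orderStat x i - b)
    (fun i _ => sub_nonneg.2 (hb _))
    (show (⟨0, hn⟩ : Fin n) ∈ Finset.univ.filter (fun i : Fin n => (i : ℕ) < k) by simp; omega)
  have h3 := le_orderStat_zero x hn j
  linarith

/-- If the threshold `t` is exceeded by `k` of the `n` samples on average, the prophet's value is at
most the expected total of all samples above `t`: this is `∑ top k ≤ k t + ∑ (x j - t)⁺` in
expectation. -/
lemma OPT_le [IsProbabilityMeasure μ] (hμ : Integrable (fun x : ℝ => x) μ) {n k : ℕ}
    (hkn : k ≤ n) {t : ℝ} (ht : n * μ.real (Ici t) = k) :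
    OPT n k μ ≤ n * ∫ y in Ici t, y ∂μ := by
  have hmax : Integrable (fun y : ℝ => max (y - t) 0) μ :=
    (hμ.sub (integrable_const t)).pos_part
  have h1 : ∫ y, max (y - t) 0 ∂μ = ∫ y in Ici t, y ∂μ - t * μ.real (Ici t) := by
    have e : (fun y : ℝ => max (y - t) 0) = (Ici t).indicator fun y => y - t := by
      funext y
      by_cases h : t ≤ y
      · rw [indicator_of_mem (mem_Ici.2 h), max_eq_left (by linarith)]
      · rw [indicator_of_notMem (by simpa using h), max_eq_right (by linarith)]
    rw [e, integral_indicator measurableSet_Ici, integral_sub hμ.integrableOn (integrable_const t),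
      setIntegral_const, smul_eq_mul, mul_comm]
  have hint : Integrable (fun x : Fin n → ℝ => k * t + ∑ j, max (x j - t) 0) (iidLaw μ n) :=
    (integrable_const _).add (integrable_finsetSum _ fun j _ => integrable_eval_iidLaw hmax j)
  rw [OPT_eq_integral_topSum hμ]
  calc ∫ x, topSum k x ∂(iidLaw μ n)
      ≤ ∫ x : Fin n → ℝ, (k * t + ∑ j, max (x j - t) 0) ∂(iidLaw μ n) :=
        integral_mono (integrable_topSum hμ n k) hint fun x => topSum_le hkn x t
    _ = k * t + n * (∫ y in Ici t, y ∂μ - t * μ.real (Ici t)) := by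
        rw [integral_add (integrable_const _)
          (integrable_finsetSum _ fun j _ => integrable_eval_iidLaw hmax j),
          integral_finsetSum _ fun j _ => integrable_eval_iidLaw hmax j]
        simp only [integral_eval_iidLaw hmax, h1]
        simp [mul_sub]
    _ = n * ∫ y in Ici t, y ∂μ := by rw [← ht]; ring

/-- The prophet collects the lower bound `b` for each of the `k` items, and in addition `L - b`
whenever some sample reaches `L`. -/
lemma le_OPT [IsProbabilityMeasure μ] (hμ : Integrable (fun x : ℝ => x) μ) {n k : ℕ}
    (hk : 1 ≤ k) (hkn : k ≤ n) {b L : ℝ} (hb : ∀ᵐ y ∂μ, b ≤ y) :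
    k * b + (L - b) * (1 - μ.real (Iio L) ^ n) ≤ OPT n k μ := by
  set B : Set (Fin n → ℝ) := Set.pi univ fun _ => Iio L with hB
  have hBm : MeasurableSet B := MeasurableSet.univ_pi fun _ => measurableSet_Iio
  have hBr : (iidLaw μ n).real Bᶜ = 1 - μ.real (Iio L) ^ n := by
    rw [probReal_compl_eq_one_sub hBm, Measure.real, iidLaw, hB, Measure.pi_pi]
    simp [Measure.real]
  have hn : 0 < n := by omega
  rw [OPT_eq_integral_topSum hμ]
  have hint : Integrable (Bᶜ.indicator fun _ => L - b) (iidLaw μ n) :=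
    (integrable_const _).indicator hBm.compl
  calc k * b + (L - b) * (1 - μ.real (Iio L) ^ n)
      = ∫ x, (k * b + Bᶜ.indicator (fun _ => L - b) x) ∂(iidLaw μ n) := by
        rw [integral_add (integrable_const _) hint, integral_indicator_const _ hBm.compl, hBr]
        simp [mul_comm]
    _ ≤ ∫ x, topSum k x ∂(iidLaw μ n) := by
        refine integral_mono_ae ((integrable_const _).add hint) (integrable_topSum hμ n k) ?_
        filter_upwards [ae_forall_eval_iidLaw (n := n) hb] with x hx
        by_cases h : x ∈ B
        · rw [indicator_of_notMem (by simpa using h)]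
          linarith [mul_le_topSum hk hkn x hx ⟨0, hn⟩, hx ⟨0, hn⟩]
        · rw [indicator_of_mem (by simpa using h)]
          obtain ⟨j, hj⟩ : ∃ j, L ≤ x j := by simpa [hB] using h
          linarith [mul_le_topSum hk hkn x hx j]

/-- The prophet's value is positive because a continuous distribution has no atom at `0`; hence the
division in `ratio` is a genuine one. -/
lemma OPT_pos (hμ : IsContinuousDist μ) {n k : ℕ} (hk : 1 ≤ k) (hkn : k ≤ n) :
    0 < OPT n k μ := by
  have := hμ.isProb
  have hmean : 0 < ∫ y, y ∂μ := by
    refine (integral_pos_iff_support_of_nonneg_ae ?_ hμ.finite_mean).2 ?_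
    · filter_upwards [hμ.ae_pos] with y hy using hy.le
    · have h : (Function.support fun y : ℝ => y) =ᵐ[μ] univ := by
        filter_upwards [hμ.ae_pos] with y hy
        exact propext ⟨fun _ => trivial, fun _ => hy.ne'⟩
      rw [measure_congr h]
      simp
  have hn : 0 < n := by omega
  refine hmean.trans_le ?_
  rw [OPT_eq_integral_topSum hμ.finite_mean, ← integral_eval_iidLaw hμ.finite_mean ⟨0, hn⟩]
  refine integral_mono_ae (integrable_eval_iidLaw hμ.finite_mean _)
    (integrable_topSum hμ.finite_mean n k) ?_
  filter_upwards [ae_forall_eval_iidLaw (n := n) hμ.ae_pos] with x hx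
  simpa using mul_le_topSum hk hkn x (fun j => (hx j).le) ⟨0, hn⟩

/-! ### The worst-case distributions -/

/-- The worst-case distributions: with probability `1 - δ` a value that is uniform on
`[b, b + δ]`, and with probability `δ` a value that is uniform on `[L, L + δ]`, where
`L = a / δ + b`. As `δ → 0` the huge values contribute `a` to the mean, and the bulk is almost
constant. -/
noncomputable def worstCase (a b δ : ℝ) : Measure ℝ :=
  ENNReal.ofReal ((1 - δ) / δ) • volume.restrict (Icc b (b + δ)) +
    volume.restrict (Icc (a / δ + b) (a / δ + b + δ))

section worstCase

variable {a b δ : ℝ}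

lemma ae_le_worstCase (ha : 0 ≤ a) (hδ : 0 < δ) : ∀ᵐ y ∂(worstCase a b δ), b ≤ y := by
  rw [worstCase, ae_add_measure_iff]
  refine ⟨Measure.ae_smul_measure ?_ _, ?_⟩
  · filter_upwards [ae_restrict_mem measurableSet_Icc] with y hy using hy.1
  · filter_upwards [ae_restrict_mem measurableSet_Icc] with y hy
    have : 0 ≤ a / δ := by positivity
    linarith [hy.1]

lemma isContinuousDist_worstCase (ha : 0 ≤ a) (hb : 0 ≤ b) (hδ : 0 < δ) (hδ1 : δ < 1) :
    IsContinuousDist (worstCase a b δ) := by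
  have hprob : IsProbabilityMeasure (worstCase a b δ) := by
    refine ⟨?_⟩
    simp only [worstCase, Measure.add_apply, Measure.smul_apply, Measure.restrict_apply_univ,
      Real.volume_Icc, smul_eq_mul, add_sub_cancel_left]
    have h1 : 0 ≤ (1 - δ) / δ := div_nonneg (by linarith) hδ.le
    rw [← ENNReal.ofReal_mul h1, ← ENNReal.ofReal_add (by positivity) hδ.le]
    rw [div_mul_cancel₀ _ hδ.ne']
    simp
  have hnull : NullSingletonClass (worstCase a b δ) := ⟨fun x => by simp [worstCase]⟩
  refine ⟨hprob, ?_, continuous_cdf, ?_⟩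
  · refine measure_mono_null (fun y hy => ?_) (ae_le_worstCase (b := b) ha hδ)
    have : y < 0 := hy
    simp only [mem_compl_iff, Set.mem_ofPred_eq, not_le]
    linarith
  · refine Integrable.add_measure (Integrable.smul_measure ?_ ENNReal.ofReal_ne_top) ?_
    · exact continuous_id.continuousOn.integrableOn_compact isCompact_Icc
    · exact continuous_id.continuousOn.integrableOn_compact isCompact_Icc

lemma measureReal_Iio_worstCase_le (ha : 0 ≤ a) (hb : 0 ≤ b) (hδ : 0 < δ) (hδ1 : δ < 1) :
    (worstCase a b δ).real (Iio (a / δ + b)) ≤ 1 - δ := by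
  have := (isContinuousDist_worstCase ha hb hδ hδ1).isProb
  have h1 : ENNReal.ofReal δ ≤ worstCase a b δ (Ici (a / δ + b)) := by
    calc ENNReal.ofReal δ
        = volume.restrict (Icc (a / δ + b) (a / δ + b + δ)) (Ici (a / δ + b)) := by
          rw [Measure.restrict_apply measurableSet_Ici, inter_eq_right.2 Icc_subset_Ici_self,
            Real.volume_Icc, add_sub_cancel_left]
      _ ≤ _ := by rw [worstCase, Measure.add_apply]; exact le_add_self
  have h2 : δ ≤ (worstCase a b δ).real (Ici (a / δ + b)) :=
    (ENNReal.ofReal_le_iff_le_toReal (measure_ne_top _ _)).1 h1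
  rw [← compl_Iio, probReal_compl_eq_one_sub measurableSet_Iio] at h2
  linarith

/-- The values above any threshold are worth at most about `b` per unit of mass, plus `a` for the
huge values. -/
lemma setIntegral_worstCase_le (ha : 0 ≤ a) (hb : 0 ≤ b) (hδ : 0 < δ) (hδ1 : δ < 1) {A : Set ℝ}
    (hA : MeasurableSet A) :
    ∫ y in A, y ∂(worstCase a b δ) ≤
      (b + δ) * (worstCase a b δ).real A + (a + (b + δ) * δ) := by
  have := (isContinuousDist_worstCase ha hb hδ hδ1).isProb
  have hc : 0 ≤ (1 - δ) / δ := div_nonneg (by linarith) hδ.le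
  have hint : ∀ u v : ℝ, IntegrableOn (fun y : ℝ => y) (A ∩ Icc u v) volume := fun u v =>
    (continuous_id.continuousOn.integrableOn_compact isCompact_Icc).mono_set inter_subset_right
  have hfin : ∀ u v : ℝ, volume (A ∩ Icc u v) ≠ ⊤ := fun u v =>
    ((measure_mono inter_subset_right).trans_lt isCompact_Icc.measure_lt_top).ne
  have hle : ∀ u v : ℝ, ∫ y in A ∩ Icc u v, y ≤ v * volume.real (A ∩ Icc u v) := by
    intro u v
    have := setIntegral_mono_on (hint u v) (integrableOn_const (hs := hfin u v) (C := v))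
      (hA.inter measurableSet_Icc) fun y hy => hy.2.2
    rwa [setIntegral_const, smul_eq_mul, mul_comm] at this
  have hsplit : ∫ y in A, y ∂(worstCase a b δ) =
      (1 - δ) / δ * (∫ y in A ∩ Icc b (b + δ), y) +
        ∫ y in A ∩ Icc (a / δ + b) (a / δ + b + δ), y := by
    rw [worstCase, Measure.restrict_add, Measure.restrict_smul, Measure.restrict_restrict hA,
      Measure.restrict_restrict hA, integral_add_measure
        ((hint _ _).smul_measure ENNReal.ofReal_ne_top) (hint _ _),
      integral_smul_measure, ENNReal.toReal_ofReal hc, smul_eq_mul]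
  have hmass : (1 - δ) / δ * volume.real (A ∩ Icc b (b + δ)) ≤ (worstCase a b δ).real A := by
    have h1 : ENNReal.ofReal ((1 - δ) / δ) * volume (A ∩ Icc b (b + δ)) ≤ worstCase a b δ A := by
      rw [worstCase, Measure.add_apply, Measure.smul_apply, Measure.restrict_apply hA, smul_eq_mul]
      exact le_self_add
    have h2 := ENNReal.toReal_mono (measure_ne_top _ _) h1
    rwa [ENNReal.toReal_mul, ENNReal.toReal_ofReal hc] at h2
  have hvol : volume.real (A ∩ Icc (a / δ + b) (a / δ + b + δ)) ≤ δ := by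
    have := measureReal_mono (μ := volume)
      (inter_subset_right : A ∩ Icc (a / δ + b) (a / δ + b + δ) ⊆ _) isCompact_Icc.measure_ne_top
    rwa [Real.volume_real_Icc_of_le (by linarith), add_sub_cancel_left] at this
  rw [hsplit]
  have h1 := mul_le_mul_of_nonneg_left (hle b (b + δ)) hc
  have h2 := mul_le_mul_of_nonneg_left hmass (by linarith : 0 ≤ b + δ)
  have h3 := hle (a / δ + b) (a / δ + b + δ)
  have h4 := mul_le_mul_of_nonneg_left hvol (by positivity : 0 ≤ a / δ + b + δ)
  have h5 : (a / δ + b + δ) * δ = a + (b + δ) * δ := by field_simp; ring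
  linarith

lemma ALG_worstCase_le {m k : ℕ} (hkm : k ≤ m) (ha : 0 ≤ a) (hb : 0 ≤ b) (hδ : 0 < δ)
    (hδ1 : δ < 1) (hab : ∀ q ∈ Icc (0 : ℝ) 1, (cappedMean m k).eval q * (a + b * q) ≤ q)
    (q : unitInterval) :
    ALG m k (worstCase a b δ) q ≤ 1 + m * δ * (b + 2) := by
  have hμ := isContinuousDist_worstCase ha hb hδ hδ1
  rcases q.2.1.eq_or_lt with hq0 | hq0
  · obtain rfl : q = 0 := Subtype.ext hq0.symm
    rw [ALG_zero hμ]
    positivity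
  have hQnn : 0 ≤ Q m k q := integral_nonneg fun _ => Nat.cast_nonneg _
  have h1 := mul_ALG hμ m k q
  have h2 := setIntegral_worstCase_le ha hb hδ hδ1 (A := _)
    (measurableSet_threshold (quantileFn (worstCase a b δ) (1 - (q : ℝ))))
  rw [measureReal_quantileFn_le hμ q] at h2
  have h3 : (b + δ) * (q : ℝ) + (a + (b + δ) * δ) ≤ (a + b * q) + δ * (b + 2) := by
    nlinarith [mul_nonneg hδ.le (sub_nonneg.2 q.2.2), mul_nonneg hδ.le (sub_nonneg.2 hδ1.le)]
  have h4 := hab q q.2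
  have h5 := eval_cappedMean_le hkm q.2
  rw [← Q_eq_eval_cappedMean hkm] at h4 h5
  have h6 := mul_le_mul_of_nonneg_left (h2.trans h3) hQnn
  have h7 := mul_le_mul_of_nonneg_right h5 (by positivity : 0 ≤ δ * (b + 2))
  refine le_of_mul_le_mul_left ?_ hq0
  rw [h1]
  linarith

lemma le_OPT_worstCase {n k : ℕ} (hk : 1 ≤ k) (hkn : k ≤ n) (ha : 0 ≤ a) (hb : 0 ≤ b) (hδ : 0 < δ)
    (hδ1 : δ < 1) :
    k * b + a * ∑ i ∈ Finset.range n, (1 - δ) ^ i ≤ OPT n k (worstCase a b δ) := by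
  have hμ := isContinuousDist_worstCase ha hb hδ hδ1
  have := hμ.isProb
  refine le_trans ?_ (le_OPT (L := a / δ + b) hμ.finite_mean hk hkn (ae_le_worstCase ha hδ))
  have h1 : (worstCase a b δ).real (Iio (a / δ + b)) ^ n ≤ (1 - δ) ^ n :=
    pow_le_pow_left₀ measureReal_nonneg (measureReal_Iio_worstCase_le ha hb hδ hδ1) n
  have h2 : δ * ∑ i ∈ Finset.range n, (1 - δ) ^ i = 1 - (1 - δ) ^ n := by
    have := mul_neg_geom_sum (1 - δ) n
    rwa [sub_sub_cancel] at this
  have h3 : a * ∑ i ∈ Finset.range n, (1 - δ) ^ i = a / δ * (1 - (1 - δ) ^ n) := by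
    rw [← h2]; field_simp
  have h4 := mul_le_mul_of_nonneg_left (sub_le_sub_left h1 1) (by positivity : 0 ≤ a / δ)
  rw [h3, add_sub_cancel_right]
  linarith

end worstCase

/-! ### The competitive ratio -/

/-- The upper bound on the competitive ratio: no quantile does better on the worst-case
distributions than `k / n`, at which the tangent line touches. -/
lemma competitiveRatio_le {m n k : ℕ} (hk : 1 ≤ k) (hkn : k ≤ n) (hkm : k ≤ m) :
    competitiveRatio m n k ≤ ((Q m k (quantileKN k n hkn) / k : ℝ) : EReal) := by
  have hk0 : (0 : ℝ) < k := by exact_mod_cast hk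
  have hn0 : (0 : ℝ) < n := by exact_mod_cast hk.trans hkn
  obtain ⟨a, b, ha, hb, hab, hQpos, hp⟩ := exists_tangent (m := m) hk hkm (p := (k : ℝ) / n)
    (by positivity) (quantileKN k n hkn).2.2
  have hQ : Q m k (quantileKN k n hkn) = (cappedMean m k).eval ((k : ℝ) / n) :=
    Q_eq_eval_cappedMean hkm _
  rw [hQ]
  have hlim : k * b + a * n = k / (cappedMean m k).eval ((k : ℝ) / n) := by
    rw [eq_div_iff hQpos.ne']
    field_simp at hp
    linarith
  have hOPT : Tendsto (fun δ : ℝ => k * b + a * ∑ i ∈ Finset.range n, (1 - δ) ^ i) (𝓝[>] 0)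
      (𝓝 (k / (cappedMean m k).eval ((k : ℝ) / n))) := by
    have h : Continuous fun δ : ℝ => k * b + a * ∑ i ∈ Finset.range n, (1 - δ) ^ i := by fun_prop
    have h := h.tendsto 0
    simp only [sub_zero, one_pow, Finset.sum_const, Finset.card_range, nsmul_eq_mul, mul_one,
      hlim] at h
    exact h.mono_left nhdsWithin_le_nhds
  have hALG : Tendsto (fun δ : ℝ => 1 + m * δ * (b + 2)) (𝓝[>] 0) (𝓝 1) := by
    have h : Continuous fun δ : ℝ => 1 + m * δ * (b + 2) := by fun_prop
    have h := h.tendsto 0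
    simp only [mul_zero, zero_mul, add_zero] at h
    exact h.mono_left nhdsWithin_le_nhds
  have hOPT0 : 0 < k / (cappedMean m k).eval ((k : ℝ) / n) := by positivity
  have hratio := hALG.div hOPT hOPT0.ne'
  rw [one_div_div] at hratio
  refine ge_of_tendsto ((continuous_coe_real_ereal.tendsto _).comp hratio) ?_
  filter_upwards [Ioo_mem_nhdsGT (zero_lt_one (α := ℝ)),
    hOPT.eventually_const_lt hOPT0] with δ hδ hpos
  refine (iInf₂_le (worstCase a b δ) (isContinuousDist_worstCase ha hb hδ.1 hδ.2)).trans ?_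
  refine iSup_le fun q => ?_
  rw [ratio]
  refine EReal.coe_le_coe_iff.2 ?_
  have := hδ.1
  exact div_le_div₀ (by positivity) (ALG_worstCase_le hkm ha hb hδ.1 hδ.2 hab q) hpos
    (le_OPT_worstCase hk hkn ha hb hδ.1 hδ.2)

/-- The quantile `k / n` guarantees the ratio `Q(k / n) / k` on every distribution: the prophet gets
at most `n` times the integral over the values above the threshold, and the algorithm gets
`Q(k / n) / (k / n)` times that integral. -/
lemma le_guarantee {m n k : ℕ} (hk : 1 ≤ k) (hkn : k ≤ n) :
    ((Q m k (quantileKN k n hkn) / k : ℝ) : EReal) ≤ guarantee m n k (quantileKN k n hkn) := by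
  refine le_iInf₂ fun μ hμ => EReal.coe_le_coe_iff.2 ?_
  have := hμ.isProb
  have hk0 : (0 : ℝ) < k := by exact_mod_cast hk
  have hn0 : (0 : ℝ) < n := by exact_mod_cast hk.trans hkn
  set q := quantileKN k n hkn with hqdef
  have hq : (q : ℝ) = k / n := rfl
  have hqpos : 0 < (q : ℝ) := by rw [hq]; positivity
  have hnq : n * (q : ℝ) = k := by rw [hq]; field_simp
  obtain ⟨s, hs, hps⟩ := exists_le_cdf μ (p := 1 - (q : ℝ)) (by linarith)
  obtain ⟨t, ht, hct⟩ := exists_quantileFn_eq hμ (by linarith [q.2.2]) hs hps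
  have h1 := mul_ALG hμ m k q
  have hset : {y : ℝ | quantileFn μ (1 - (q : ℝ)) ≤ (y : EReal)} = Ici t := by
    rw [ht]
    ext y
    simp
  rw [hset] at h1
  have h2 := OPT_le hμ.finite_mean hkn (t := t) (by rw [measureReal_Ici_of_cdf hμ hct, hnq])
  have hQnn : 0 ≤ Q m k q := integral_nonneg fun _ => Nat.cast_nonneg _
  rw [div_le_div_iff₀ hk0 (OPT_pos hμ hk hkn)]
  calc Q m k q * OPT n k μ ≤ Q m k q * (n * ∫ y in Ici t, y ∂μ) :=
        mul_le_mul_of_nonneg_left h2 hQnn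
    _ = n * (q * ALG m k μ q) := by rw [h1]; ring
    _ = ALG m k μ q * k := by rw [← hnq]; ring

lemma guarantee_le_competitiveRatio (m n k : ℕ) (q : unitInterval) :
    guarantee m n k q ≤ competitiveRatio m n k :=
  iInf₂_mono fun μ _ => le_iSup (fun q => ratio m n k μ q) q

end SingleThreshold

theorem mainTheorem1 (m n k : ℕ) (hk : 1 ≤ k) (hkn : k ≤ n) (hkm : k ≤ m) :
    SingleThreshold.competitiveRatio m n k =
        ((SingleThreshold.Q m k (SingleThreshold.quantileKN k n hkn) / k : ℝ) : EReal) ∧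
      SingleThreshold.Q m k (SingleThreshold.quantileKN k n hkn) / k =
        (1 / (k : ℝ)) * ((k : ℝ) - ∑ l ∈ Finset.range k,
          ((k : ℝ) - l) * (m.choose l : ℝ) * ((k : ℝ) / n) ^ l * (1 - (k : ℝ) / n) ^ (m - l)) ∧
      SingleThreshold.guarantee m n k (SingleThreshold.quantileKN k n hkn) =
        SingleThreshold.competitiveRatio m n k ∧
      ∀ q : unitInterval, SingleThreshold.guarantee m n k q ≤
        SingleThreshold.guarantee m n k (SingleThreshold.quantileKN k n hkn) := by
  have h1 := SingleThreshold.competitiveRatio_le (m := m) hk hkn hkm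
  have h2 := SingleThreshold.le_guarantee (m := m) hk hkn
  have h3 := SingleThreshold.guarantee_le_competitiveRatio m n k
  refine ⟨le_antisymm h1 (h2.trans (h3 _)), ?_, le_antisymm (h3 _) (h1.trans h2),
    fun q => (h3 q).trans (h1.trans h2)⟩
  rw [SingleThreshold.Q_eq_eval_cappedMean hkm, SingleThreshold.eval_cappedMean_eq, div_eq_inv_mul,
    one_div]
  rfl
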